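/- Let $H_1,H_2\in(0,1)$ and let $X=\{X(\mathbf t),\ \mathbf t=(t_1,t_2)\in[0,\infty)^2\}$ be a centered Gaussian random field on a probability space $(\Omega,\mathcal F,\mathbf P)$ such that (a) $X$ is self-similar with index $(H_1,H_2)$: for all $a_1,a_2>0$ the fields $\{X(a_1t_1,a_2t_2)\}_{\mathbf t\in[0,\infty)^2}$ and $\{a_1^{H_1}a_2^{H_2}X(\mathbf t)\}_{\mathbf t\in[0,\infty)^2}$ have the same finite-dimensional distributions; (b) $X$ has stationary rectangular increments: with $\Delta_{\mathbf u}X(\mathbf v)=X(v_1,v_2)-X(u_1,v_2)-X(v_1,u_2)+X(u_1,u_2)$, for every $\mathbf u=(u_1,u_2)\in[0,\infty)^2$ the fields $\{\Delta_{\mathbf u}X(\mathbf u+\mathbf h)\}_{\mathbf h\in[0,\infty)^2}$ and $\{\Delta_{\mathbf 0}X(\mathbf h)\}_{\mathbf h\in[0,\infty)^2}$ have the same finite-dimensional distributions; (c) $\mathbf E X(1,1)^2=1$; (d) $X$ is separable on $\mathbf T=[1,\infty)^2$ equipped with the metric $\rho_2(\mathbf t,\mathbf s)=|t_1-s_1|^{H_1}+|t_2-s_2|^{H_2}$,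 that is, there is a countable dense $S\subset\mathbf T$ such that almost surely, for every $\mathbf t\in\mathbf T$ and $\delta>0$, the value $X(\mathbf t)$ lies in the closure of $\{X(\mathbf s):\mathbf s\in S,\ \rho_2(\mathbf t,\mathbf s)<\delta\}$. Let $\varphi:(0,\infty)^2\to(0,\infty)$ be increasing (not necessarily strictly) in each coordinate and such that $\sum_{n=0}^\infty\sum_{m=0}^\infty \exp\{-D\varphi(2^n,2^m)\}<\infty$ for every $D>0$. Put $H=\min\{H_1,H_2\}$, $\eta=\max\{H_1,H_2\}$, $Q=\frac1{H_1}+\frac1{H_2}$, $$N_1=\Big(\frac{H_1+H_2}{H_2}\Big)^{1/H_1}+3,\qquad N_2=\Big(\frac{H_1+H_2}{H_1}\Big)^{1/H_2}+3,$$ $$C_1=N_1N_2\exp\Big\{Q+\frac1{2(4^{H_1+H_2}+1)}\Big\},\qquad C_2=\frac{3}{2\cdot4^{\eta}\,(3\cdot4^{H}+4^{1-H})}.$$ Then for every $\varepsilon>\frac{2}{\varphi(1,1)}$ the series on the right-hand side below converges and $$\mathbf P\Big\{\sup_{\mathbf t\in[1,\infty)^2}\frac{|X(\mathbf t)|}{t_1^{H_1}t_2^{H_2}\varphi(\mathbf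 t)}>\varepsilon\Big\}\le C_1\,\varepsilon^{2Q}\sum_{n=0}^\infty\sum_{m=0}^\infty\varphi^{2Q}(2^n,2^m)\exp\{-C_2\,\varepsilon^2\varphi^2(2^n,2^m)\}.$$ -/

import Mathlib

open MeasureTheory ProbabilityTheory Set
open scoped NNReal

noncomputable section

namespace GaussianField

/-- Equality of all finite-dimensional distributions of two real random fields. -/
def SameFDD {Ω T : Type*} [MeasurableSpace Ω] (X Y : T → Ω → ℝ) (μ : Measure Ω) : Prop :=
  ∀ I : Finset T, IdentDistrib (fun ω (t : I) => X t ω) (fun ω (t : I) => Y t ω) μ μ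

/-- Self-similarity with index `(H₁, H₂)` of a field indexed by `[0,∞)²`. -/
def IsSelfSimilar {Ω : Type*} [MeasurableSpace Ω] (X : ℝ≥0 × ℝ≥0 → Ω → ℝ) (H₁ H₂ : ℝ)
    (μ : Measure Ω) : Prop :=
  ∀ a₁ a₂ : ℝ≥0, 0 < a₁ → 0 < a₂ →
    SameFDD (fun t ω => X (a₁ * t.1, a₂ * t.2) ω)
      (fun t ω => (a₁ : ℝ) ^ H₁ * (a₂ : ℝ) ^ H₂ * X t ω) μ

/-- The rectangular increment `Δ_u X(v)`. -/
def rectIncrement {Ω : Type*} (X : ℝ≥0 × ℝ≥0 → Ω → ℝ) (u v : ℝ≥0 × ℝ≥0) (ω : Ω) : ℝ :=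
  X (v.1, v.2) ω - X (u.1, v.2) ω - X (v.1, u.2) ω + X (u.1, u.2) ω

/-- Stationarity of the rectangular increments. If a coordinate of `h` is zero, both increments
vanish identically, so it is harmless to let `h` range over all of `[0,∞)²`. -/
def HasStationaryRectIncrements {Ω : Type*} [MeasurableSpace Ω] (X : ℝ≥0 × ℝ≥0 → Ω → ℝ)
    (μ : Measure Ω) : Prop :=
  ∀ u : ℝ≥0 × ℝ≥0,
    SameFDD (fun h ω => rectIncrement X u (u + h) ω) (fun h ω => rectIncrement X 0 h ω) μ

/-- The anisotropic metric `ρ₂(t, s) = |t₁ - s₁| ^ H₁ + |t₂ - s₂| ^ H₂`. -/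
def rho2 (H₁ H₂ : ℝ) (t s : ℝ≥0 × ℝ≥0) : ℝ :=
  |(t.1 : ℝ) - s.1| ^ H₁ + |(t.2 : ℝ) - s.2| ^ H₂

/-- Separability (in the sense of Doob, with respect to closed sets) on `T`, for the metric `ρ`,
of a random field: there is a countable dense `S ⊆ T` such that, outside a null set, every value
`X(t)`, `t ∈ T`, is a limit of values of `X` at points of `S` arbitrarily close to `t`.
Equivalently, outside one null set, for all `ρ`-open `U ⊆ T` and all closed `F ⊆ ℝ`,
if `X(s) ∈ F` for all `s ∈ U ∩ S` then `X(t) ∈ F` for all `t ∈ U`. -/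
def IsSeparableOn {Ω I : Type*} [MeasurableSpace Ω] (X : I → Ω → ℝ) (T : Set I)
    (ρ : I → I → ℝ) (μ : Measure Ω) : Prop :=
  ∃ S : Set I, S ⊆ T ∧ S.Countable ∧ (∀ t ∈ T, ∀ δ : ℝ, 0 < δ → ∃ s ∈ S, ρ t s < δ) ∧
    ∀ᵐ ω ∂μ, ∀ t ∈ T, ∀ δ : ℝ, 0 < δ →
      X t ω ∈ closure ((fun s => X s ω) '' {s ∈ S | ρ t s < δ})

/-- The quadrant `[1,∞)²`. -/
def quadrant : Set (ℝ≥0 × ℝ≥0) := {t | 1 ≤ t.1 ∧ 1 ≤ t.2}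

/-- `Q = 1/H₁ + 1/H₂`. -/
def Q (H₁ H₂ : ℝ) : ℝ := 1 / H₁ + 1 / H₂

/-- `N₁ = ((H₁+H₂)/H₂)^{1/H₁} + 3`. -/
def N₁ (H₁ H₂ : ℝ) : ℝ := ((H₁ + H₂) / H₂) ^ (1 / H₁) + 3

/-- `N₂ = ((H₁+H₂)/H₁)^{1/H₂} + 3`. -/
def N₂ (H₁ H₂ : ℝ) : ℝ := ((H₁ + H₂) / H₁) ^ (1 / H₂) + 3

/-- `C₁ = N₁ N₂ exp(Q + 1/(2(4^{H₁+H₂}+1)))`. -/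
def C₁ (H₁ H₂ : ℝ) : ℝ :=
  N₁ H₁ H₂ * N₂ H₁ H₂ * Real.exp (Q H₁ H₂ + 1 / (2 * ((4 : ℝ) ^ (H₁ + H₂) + 1)))

/-- `C₂ = 3/(2·4^η(3·4^H+4^{1-H}))` with `η = max(H₁,H₂)` and `H = min(H₁,H₂)`. -/
def C₂ (H₁ H₂ : ℝ) : ℝ :=
  3 / (2 * (4 : ℝ) ^ max H₁ H₂ *
    ((4 : ℝ) ^ min H₁ H₂ * 3 + (4 : ℝ) ^ (1 - min H₁ H₂)))

end GaussianField

end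

namespace GaussianField

open Filter Topology

variable {Ω : Type*} [MeasurableSpace Ω] {μ : Measure Ω}

/-! Self-similarity and stationary rectangular increments determine the variance of `X` and of its
increments along each axis; `IsSheetLike` records these second moments, the only information about
the law used beyond Gaussianity.

The quadrant is cut into dyadic blocks with lower corners (2^n, 2^m). On a block the denominator is
at least its corner value, so an exceedance forces the rescaled field, again `IsSheetLike`, above u
= εφ(2^n, 2^m) > 2 somewhere in [0,2]². Summing over blocks reduces everything to the tail bound
C₁u^{2Q}exp(-C₂u²) of `measure_exists_abs_gt_le_C₁`.

That bound is chaining over grids with a_k = u⁻²4⁻ᵏ, spending u - 1 on the coarsest grid and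
2^{-(k+1)} on the k-th links. The grids have at most 9a_k^{-Q} points. `C₂_mul_sq_le` compares the
coarsest Gaussian exponent with C₂u², `C₂_mul_le` and `four_pow_rpow_mul_exp_le` make the links a
geometric series, and `le_C₁` absorbs the numerical factors. Separability supplies a countable set
on which chaining suffices. -/

/-- The two-sided Gaussian tail bound. -/
lemma measure_abs_gt_le_of_hasGaussianLaw [IsProbabilityMeasure μ] {Z : Ω → ℝ}
    (hZ : HasGaussianLaw Z μ) (h0 : ∫ ω, Z ω ∂μ = 0) {v y : ℝ} (hv : 0 < v)
    (hZv : ∫ ω, Z ω ^ 2 ∂μ ≤ v) (hy : 0 ≤ y) :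
    μ {ω | y < |Z ω|} ≤ ENNReal.ofReal (2 * Real.exp (-(y ^ 2 / (2 * v)))) := by
  have hmap : μ.map Z = gaussianReal 0 (Var[Z; μ]).toNNReal := by
    rw [hZ.map_eq_gaussianReal, h0]
  have hvar : Var[Z; μ] ≤ v := by
    rw [variance_eq_integral hZ.aemeasurable, h0]
    simpa using hZv
  have hsub : HasSubgaussianMGF Z v.toNNReal μ := by
    refine ⟨fun t => ?_, fun t => ?_⟩
    · have := integrable_exp_mul_gaussianReal (μ := 0) (v := (Var[Z; μ]).toNNReal) t
      rw [← hmap] at this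
      exact this.comp_aemeasurable hZ.aemeasurable
    · rw [mgf_gaussianReal hmap, Real.coe_toNNReal _ (variance_nonneg _ _),
        Real.coe_toNNReal _ hv.le]
      gcongr
      nlinarith [sq_nonneg t]
  have h1 := hsub.measure_ge_le hy
  have h2 := hsub.neg.measure_ge_le hy
  rw [Real.coe_toNNReal _ hv.le] at h1 h2
  have hsubset : {ω | y < |Z ω|} ⊆ {ω | y ≤ Z ω} ∪ {ω | y ≤ (-Z) ω} := by
    intro ω hω
    rcases lt_abs.1 (show y < |Z ω| from hω) with h | h
    · exact Or.inl h.le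
    · exact Or.inr h.le
  rw [← ofReal_measureReal]
  refine ENNReal.ofReal_le_ofReal ?_
  calc μ.real {ω | y < |Z ω|} ≤ μ.real ({ω | y ≤ Z ω} ∪ {ω | y ≤ (-Z) ω}) :=
        measureReal_mono hsubset
    _ ≤ μ.real {ω | y ≤ Z ω} + μ.real {ω | y ≤ (-Z) ω} := measureReal_union_le _ _
    _ ≤ _ := by
        rw [neg_div] at h1 h2
        linarith

/-! ### Second moments of the field -/

/-- Centered Gaussian fields on the quadrant which have the variance function and the
one-directional increments of a fractional Brownian sheet. -/
structure IsSheetLike (X : ℝ≥0 × ℝ≥0 → Ω → ℝ) (H₁ H₂ : ℝ) (μ : Measure Ω) : Prop where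
  gaussian : IsGaussianProcess X μ
  centered : ∀ t, ∫ ω, X t ω ∂μ = 0
  integral_sq : ∀ t, ∫ ω, X t ω ^ 2 ∂μ = (t.1 : ℝ) ^ (2 * H₁) * (t.2 : ℝ) ^ (2 * H₂)
  integral_incr_fst : ∀ x r y : ℝ≥0,
    ∫ ω, (X (x + r, y) ω - X (x, y) ω) ^ 2 ∂μ = (r : ℝ) ^ (2 * H₁) * (y : ℝ) ^ (2 * H₂)
  integral_incr_snd : ∀ x y r : ℝ≥0,
    ∫ ω, (X (x, y + r) ω - X (x, y) ω) ^ 2 ∂μ = (x : ℝ) ^ (2 * H₁) * (r : ℝ) ^ (2 * H₂)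

lemma SameFDD.identDistrib {T : Type*} {X Y : T → Ω → ℝ} (h : SameFDD X Y μ) (t : T) :
    IdentDistrib (X t) (Y t) μ μ :=
  (h {t}).comp (u := fun f : ({t} : Finset T) → ℝ => f ⟨t, Finset.mem_singleton_self t⟩)
    (by fun_prop)

lemma IsSelfSimilar.integral_sq_mul {X : ℝ≥0 × ℝ≥0 → Ω → ℝ} {H₁ H₂ : ℝ}
    (h : IsSelfSimilar X H₁ H₂ μ) {a₁ a₂ : ℝ≥0} (h₁ : 0 < a₁) (h₂ : 0 < a₂) (t : ℝ≥0 × ℝ≥0) :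
    ∫ ω, X (a₁ * t.1, a₂ * t.2) ω ^ 2 ∂μ =
      (a₁ : ℝ) ^ (2 * H₁) * (a₂ : ℝ) ^ (2 * H₂) * ∫ ω, X t ω ^ 2 ∂μ := by
  rw [((h a₁ a₂ h₁ h₂).identDistrib t).sq.integral_eq, ← integral_const_mul]
  congr 1 with ω
  rw [mul_pow, mul_pow, mul_comm 2 H₁, mul_comm 2 H₂, Real.rpow_mul a₁.coe_nonneg,
    Real.rpow_mul a₂.coe_nonneg]
  norm_num

/-- Off the axes, rescale from (1,1). On an axis, doubling the zero coordinate fixes the point but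
multiplies the second moment by 2^{2H} > 1, so it is zero. -/
lemma IsSelfSimilar.integral_sq_eq {X : ℝ≥0 × ℝ≥0 → Ω → ℝ} {H₁ H₂ : ℝ}
    (h : IsSelfSimilar X H₁ H₂ μ) (hH₁ : 0 < H₁) (hH₂ : 0 < H₂)
    (hnorm : ∫ ω, X (1, 1) ω ^ 2 ∂μ = 1) (t : ℝ≥0 × ℝ≥0) :
    ∫ ω, X t ω ^ 2 ∂μ = (t.1 : ℝ) ^ (2 * H₁) * (t.2 : ℝ) ^ (2 * H₂) := by
  obtain ⟨x, y⟩ := t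
  rcases eq_zero_or_pos x with rfl | hx
  · have := h.integral_sq_mul (a₁ := 2) (a₂ := 1) (by norm_num) (by norm_num) (0, y)
    have h2 : (1 : ℝ) < 2 ^ (2 * H₁) := Real.one_lt_rpow (by norm_num) (by positivity)
    simp only [mul_zero, one_mul, NNReal.coe_one, Real.one_rpow, mul_one, NNReal.coe_ofNat] at this
    have h0 : ∫ ω, X (0, y) ω ^ 2 ∂μ = 0 := by nlinarith
    simp [h0, Real.zero_rpow (mul_ne_zero two_ne_zero hH₁.ne')]
  rcases eq_zero_or_pos y with rfl | hy
  · have := h.integral_sq_mul (a₁ := 1) (a₂ := 2) (by norm_num) (by norm_num) (x, 0)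
    have h2 : (1 : ℝ) < 2 ^ (2 * H₂) := Real.one_lt_rpow (by norm_num) (by positivity)
    simp only [mul_zero, one_mul, NNReal.coe_one, Real.one_rpow, NNReal.coe_ofNat] at this
    have h0 : ∫ ω, X (x, 0) ω ^ 2 ∂μ = 0 := by nlinarith
    simp [h0, Real.zero_rpow (mul_ne_zero two_ne_zero hH₂.ne')]
  have := h.integral_sq_mul hx hy (1, 1)
  simpa [hnorm] using this

lemma _root_.ProbabilityTheory.HasGaussianLaw.ae_eq_zero {Z : Ω → ℝ} (hZ : HasGaussianLaw Z μ)
    (h : ∫ ω, Z ω ^ 2 ∂μ = 0) : Z =ᵐ[μ] 0 := by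
  rw [integral_eq_zero_iff_of_nonneg (fun ω => sq_nonneg _) hZ.memLp_two.integrable_sq] at h
  filter_upwards [h] with ω hω
  simpa using hω

/-- The field vanishes almost surely at each point of the axes, so an increment in one direction is
a rectangular increment with one side on an axis, and stationarity moves it to the origin. -/
lemma isSheetLike {X : ℝ≥0 × ℝ≥0 → Ω → ℝ} {H₁ H₂ : ℝ} (hH₁ : 0 < H₁) (hH₂ : 0 < H₂)
    (hGauss : IsGaussianProcess X μ) (hcent : ∀ t, ∫ ω, X t ω ∂μ = 0)
    (hself : IsSelfSimilar X H₁ H₂ μ) (hincr : HasStationaryRectIncrements X μ)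
    (hnorm : ∫ ω, X (1, 1) ω ^ 2 ∂μ = 1) : IsSheetLike X H₁ H₂ μ := by
  have hsq := hself.integral_sq_eq hH₁ hH₂ hnorm
  have hfst (y : ℝ≥0) : X (0, y) =ᵐ[μ] 0 :=
    (hGauss.hasGaussianLaw_eval _).ae_eq_zero (by
      simp [hsq, Real.zero_rpow (mul_ne_zero two_ne_zero hH₁.ne')])
  have hsnd (x : ℝ≥0) : X (x, 0) =ᵐ[μ] 0 :=
    (hGauss.hasGaussianLaw_eval _).ae_eq_zero (by
      simp [hsq, Real.zero_rpow (mul_ne_zero two_ne_zero hH₂.ne')])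
  have hzero (h : ℝ≥0 × ℝ≥0) : (rectIncrement X 0 h) =ᵐ[μ] X h := by
    filter_upwards [hfst h.2, hsnd h.1, hsnd 0] with ω h1 h2 h3
    simp [rectIncrement, h1, h2, h3]
  have key (u h : ℝ≥0 × ℝ≥0) : ∫ ω, rectIncrement X u (u + h) ω ^ 2 ∂μ =
      (h.1 : ℝ) ^ (2 * H₁) * (h.2 : ℝ) ^ (2 * H₂) := by
    rw [← hsq, ((hincr u).identDistrib h).sq.integral_eq]
    refine integral_congr_ae ?_
    filter_upwards [hzero h] with ω hω
    rw [hω]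
  refine ⟨hGauss, hcent, hsq, fun x r y => ?_, fun x y r => ?_⟩
  · rw [← key (x, 0) (r, y)]
    refine integral_congr_ae ?_
    filter_upwards [hsnd x, hsnd (x + r)] with ω h1 h2
    simp [rectIncrement, h1, h2]
  · rw [← key (0, y) (x, r)]
    refine integral_congr_ae ?_
    filter_upwards [hfst y, hfst (y + r)] with ω h1 h2
    simp [rectIncrement, h1, h2]

lemma IsSheetLike.scale {X : ℝ≥0 × ℝ≥0 → Ω → ℝ} {H₁ H₂ : ℝ} (hX : IsSheetLike X H₁ H₂ μ)
    {a b : ℝ≥0} (ha : 0 < a) (hb : 0 < b) :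
    IsSheetLike (fun t ω => ((a : ℝ) ^ H₁ * (b : ℝ) ^ H₂)⁻¹ * X (a * t.1, b * t.2) ω)
      H₁ H₂ μ := by
  have ha' : (0 : ℝ) < (a : ℝ) := ha
  have hb' : (0 : ℝ) < (b : ℝ) := hb
  have hc : (((a : ℝ) ^ H₁ * (b : ℝ) ^ H₂)⁻¹) ^ 2 *
      ((a : ℝ) ^ (2 * H₁) * (b : ℝ) ^ (2 * H₂)) = 1 := by
    rw [mul_comm 2 H₁, mul_comm 2 H₂, Real.rpow_mul ha'.le, Real.rpow_mul hb'.le,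
      Real.rpow_two, Real.rpow_two]
    have := Real.rpow_pos_of_pos ha' H₁
    have := Real.rpow_pos_of_pos hb' H₂
    field_simp
  refine ⟨?_, fun t => ?_, fun t => ?_, fun x r y => ?_, fun x y r => ?_⟩
  · exact (hX.gaussian.comp_right (fun t : ℝ≥0 × ℝ≥0 => (a * t.1, b * t.2))).smul
      (fun _ => ((a : ℝ) ^ H₁ * (b : ℝ) ^ H₂)⁻¹)
  · rw [integral_const_mul, hX.centered, mul_zero]
  · simp only [mul_pow]
    rw [integral_const_mul, hX.integral_sq, NNReal.coe_mul, NNReal.coe_mul,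
      Real.mul_rpow a.coe_nonneg t.1.coe_nonneg, Real.mul_rpow b.coe_nonneg t.2.coe_nonneg]
    linear_combination ((t.1 : ℝ) ^ (2 * H₁) * (t.2 : ℝ) ^ (2 * H₂)) * hc
  · simp only [← mul_sub, mul_pow, mul_add]
    rw [integral_const_mul, hX.integral_incr_fst, NNReal.coe_mul, NNReal.coe_mul,
      Real.mul_rpow a.coe_nonneg r.coe_nonneg, Real.mul_rpow b.coe_nonneg y.coe_nonneg]
    linear_combination ((r : ℝ) ^ (2 * H₁) * (y : ℝ) ^ (2 * H₂)) * hc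
  · simp only [← mul_sub, mul_pow, mul_add]
    rw [integral_const_mul, hX.integral_incr_snd, NNReal.coe_mul, NNReal.coe_mul,
      Real.mul_rpow a.coe_nonneg x.coe_nonneg, Real.mul_rpow b.coe_nonneg r.coe_nonneg]
    linear_combination ((x : ℝ) ^ (2 * H₁) * (r : ℝ) ^ (2 * H₂)) * hc

/-! ### Grids in [0,2]² and oscillation over a cell -/

/-- The lower left corner of the cell of the grid of mesh `h` which contains `t`. -/
noncomputable def gridProj (h t : ℝ≥0 × ℝ≥0) : ℝ≥0 × ℝ≥0 :=
  (h.1 * ⌊t.1 / h.1⌋₊, h.2 * ⌊t.2 / h.2⌋₊)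

/-- The points of the grid of mesh `h` in `[0,2]²`. -/
noncomputable def gridPoints (h : ℝ≥0 × ℝ≥0) : Finset (ℝ≥0 × ℝ≥0) :=
  (Finset.range (⌊2 / h.1⌋₊ + 1) ×ˢ Finset.range (⌊2 / h.2⌋₊ + 1)).image
    fun i => (h.1 * (i.1 : ℝ≥0), h.2 * (i.2 : ℝ≥0))

lemma nnreal_mul_div_le (h x : ℝ≥0) : h * (x / h) ≤ x := by
  rcases eq_or_ne h 0 with rfl | hh
  · simp
  · rw [mul_div_cancel₀ _ hh]

lemma gridProj_le (h t : ℝ≥0 × ℝ≥0) : gridProj h t ≤ t := by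
  constructor
  · exact (mul_le_mul_right (Nat.floor_le zero_le) _).trans (nnreal_mul_div_le _ _)
  · exact (mul_le_mul_right (Nat.floor_le zero_le) _).trans (nnreal_mul_div_le _ _)

lemma sub_mul_floor_le {h : ℝ≥0} (hh : 0 < h) (x : ℝ≥0) : x - h * ⌊x / h⌋₊ ≤ h := by
  rw [tsub_le_iff_left]
  have := (Nat.lt_floor_add_one (x / h)).le
  rw [div_le_iff₀ hh] at this
  calc x ≤ _ := this
    _ = _ := by ring

lemma gridProj_mem {h t : ℝ≥0 × ℝ≥0} (ht : t ≤ (2, 2)) :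
    gridProj h t ∈ gridPoints h := by
  refine Finset.mem_image.2 ⟨(⌊t.1 / h.1⌋₊, ⌊t.2 / h.2⌋₊), ?_, rfl⟩
  simp only [Finset.mem_product, Finset.mem_range, Nat.lt_succ_iff]
  exact ⟨Nat.floor_mono (div_le_div_of_nonneg_right ht.1 zero_le),
    Nat.floor_mono (div_le_div_of_nonneg_right ht.2 zero_le)⟩

lemma le_of_mem_gridPoints {h t : ℝ≥0 × ℝ≥0} (ht : t ∈ gridPoints h) : t ≤ (2, 2) := by
  obtain ⟨⟨i, j⟩, hi, rfl⟩ := Finset.mem_image.1 ht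
  simp only [Finset.mem_product, Finset.mem_range, Nat.lt_succ_iff] at hi
  have key (n : ℕ) (x : ℝ≥0) (hn : n ≤ ⌊2 / x⌋₊) : x * n ≤ 2 := by
    calc x * n ≤ x * (2 / x) := by
          gcongr
          exact (Nat.cast_le.2 hn).trans (Nat.floor_le zero_le)
      _ ≤ 2 := (nnreal_mul_div_le _ _)
  exact ⟨key _ _ hi.1, key _ _ hi.2⟩

lemma card_gridPoints_le {h : ℝ≥0 × ℝ≥0} (h₁ : 0 < h.1) (h₂ : 0 < h.2) (h₁' : h.1 ≤ 1)
    (h₂' : h.2 ≤ 1) : ((gridPoints h).card : ℝ≥0) ≤ 9 * (h.1⁻¹ * h.2⁻¹) := by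
  have key (x : ℝ≥0) (hx : 0 < x) (hx1 : x ≤ 1) : ((⌊2 / x⌋₊ + 1 : ℕ) : ℝ≥0) ≤ 3 * x⁻¹ := by
    have h1 : (⌊2 / x⌋₊ : ℝ≥0) ≤ 2 / x := Nat.floor_le zero_le
    have h2 : 1 ≤ x⁻¹ := (one_le_inv₀ hx).2 hx1
    push_cast
    calc (⌊2 / x⌋₊ : ℝ≥0) + 1 ≤ 2 / x + x⁻¹ := add_le_add h1 h2
      _ = 3 * x⁻¹ := by rw [div_eq_mul_inv]; ring
  calc ((gridPoints h).card : ℝ≥0)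
      ≤ ((⌊2 / h.1⌋₊ + 1 : ℕ) : ℝ≥0) * ((⌊2 / h.2⌋₊ + 1 : ℕ) : ℝ≥0) := by
        rw [← Nat.cast_mul, Nat.cast_le]
        refine Finset.card_image_le.trans ?_
        simp
    _ ≤ (3 * h.1⁻¹) * (3 * h.2⁻¹) := mul_le_mul' (key _ h₁ h₁') (key _ h₂ h₂')
    _ = _ := by ring

variable {X : ℝ≥0 × ℝ≥0 → Ω → ℝ} {H₁ H₂ : ℝ}

lemma IsSheetLike.hasGaussianLaw_sub (hX : IsSheetLike X H₁ H₂ μ) (s t : ℝ≥0 × ℝ≥0) :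
    HasGaussianLaw (fun ω => X s ω - X t ω) μ :=
  hX.gaussian.hasGaussianLaw_fun_sub

lemma IsSheetLike.integral_sub (hX : IsSheetLike X H₁ H₂ μ) (s t : ℝ≥0 × ℝ≥0) :
    ∫ ω, X s ω - X t ω ∂μ = 0 := by
  rw [MeasureTheory.integral_sub (hX.gaussian.hasGaussianLaw_eval s).integrable
    (hX.gaussian.hasGaussianLaw_eval t).integrable, hX.centered, hX.centered, sub_zero]

/-- Move from the grid corner to `t` one coordinate at a time and use (a + b)² ≤ 2(a² + b²); the
coordinate held fixed is at most 2. -/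
lemma IsSheetLike.integral_sq_sub_gridProj_le (hX : IsSheetLike X H₁ H₂ μ) (hH₁ : 0 < H₁)
    (hH₂ : 0 < H₂) {h t : ℝ≥0 × ℝ≥0} (h₁ : 0 < h.1) (h₂ : 0 < h.2) (ht : t ≤ (2, 2)) :
    ∫ ω, (X t ω - X (gridProj h t) ω) ^ 2 ∂μ ≤
      2 * ((h.1 : ℝ) ^ (2 * H₁) * 2 ^ (2 * H₂) + 2 ^ (2 * H₁) * (h.2 : ℝ) ^ (2 * H₂)) := by
  have hle := gridProj_le h t
  obtain ⟨x, hx⟩ : ∃ x, x = (gridProj h t).1 := ⟨_, rfl⟩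
  obtain ⟨y, hy⟩ : ∃ y, y = (gridProj h t).2 := ⟨_, rfl⟩
  obtain ⟨r, hr⟩ : ∃ r, r = t.1 - x := ⟨_, rfl⟩
  obtain ⟨q, hq⟩ : ∃ q, q = t.2 - y := ⟨_, rfl⟩
  have hr' : r ≤ h.1 := by rw [hr, hx]; exact sub_mul_floor_le h₁ _
  have hq' : q ≤ h.2 := by rw [hq, hy]; exact sub_mul_floor_le h₂ _
  have hxt : x ≤ t.1 := hx ▸ hle.1
  have hyt : y ≤ t.2 := hy ▸ hle.2
  have ht1 : t.1 = x + r := by rw [hr, add_tsub_cancel_of_le hxt]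
  have ht2 : t.2 = y + q := by rw [hq, add_tsub_cancel_of_le hyt]
  have htt : t = (x + r, y + q) := by rw [← ht1, ← ht2]
  have hg : gridProj h t = (x, y) := by rw [hx, hy]
  have hx2 : x ≤ 2 := hxt.trans ht.1
  have hyq2 : y + q ≤ 2 := ht2 ▸ ht.2
  have e1 := hX.integral_incr_fst x r (y + q)
  have e2 := hX.integral_incr_snd x y q
  have i1 := (hX.hasGaussianLaw_sub (x + r, y + q) (x, y + q)).memLp_two.integrable_sq
  have i2 := (hX.hasGaussianLaw_sub (x, y + q) (x, y)).memLp_two.integrable_sq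
  have i3 := (hX.hasGaussianLaw_sub (x + r, y + q) (x, y)).memLp_two.integrable_sq
  rw [hg, htt]
  calc ∫ ω, (X (x + r, y + q) ω - X (x, y) ω) ^ 2 ∂μ
      ≤ ∫ ω, 2 * ((X (x + r, y + q) ω - X (x, y + q) ω) ^ 2 +
          (X (x, y + q) ω - X (x, y) ω) ^ 2) ∂μ := by
        refine integral_mono i3 ((i1.add i2).const_mul 2) fun ω => ?_
        dsimp only
        nlinarith [sq_nonneg ((X (x + r, y + q) ω - X (x, y + q) ω) -
          (X (x, y + q) ω - X (x, y) ω))]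
    _ = 2 * ((r : ℝ) ^ (2 * H₁) * ((y + q : ℝ≥0) : ℝ) ^ (2 * H₂) +
          (x : ℝ) ^ (2 * H₁) * (q : ℝ) ^ (2 * H₂)) := by
        rw [integral_const_mul, integral_add i1 i2, e1, e2]
    _ ≤ _ := by
        gcongr
        · exact_mod_cast hyq2
        · exact_mod_cast hx2

lemma IsSheetLike.integral_sq_le (hX : IsSheetLike X H₁ H₂ μ) (hH₁ : 0 < H₁)
    (hH₂ : 0 < H₂) {t : ℝ≥0 × ℝ≥0} (ht : t ≤ (2, 2)) :
    ∫ ω, X t ω ^ 2 ∂μ ≤ 4 ^ (H₁ + H₂) := by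
  rw [hX.integral_sq]
  have h4 : (4 : ℝ) ^ (H₁ + H₂) = 2 ^ (2 * H₁) * 2 ^ (2 * H₂) := by
    rw [← Real.rpow_add two_pos, ← mul_add, Real.rpow_mul zero_le_two]
    norm_num
  rw [h4]
  have := ht.1
  have := ht.2
  gcongr
  · exact_mod_cast ht.1
  · exact_mod_cast ht.2

/-- The mesh for which the field oscillates by a multiple of `a` in each cell of the grid. -/
noncomputable def mesh (H₁ H₂ : ℝ) (a : ℝ≥0) : ℝ≥0 × ℝ≥0 := (a ^ (1 / H₁), a ^ (1 / H₂))

lemma card_gridPoints_mesh_le (hH₁ : 0 < H₁) (hH₂ : 0 < H₂) {a : ℝ≥0} (ha : 0 < a)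
    (ha1 : a ≤ 1) :
    ((gridPoints (mesh H₁ H₂ a)).card : ℝ) ≤ 9 * (a⁻¹ : ℝ) ^ (Q H₁ H₂) := by
  have h := card_gridPoints_le (h := mesh H₁ H₂ a) (NNReal.rpow_pos ha) (NNReal.rpow_pos ha)
    (NNReal.rpow_le_one ha1 (by positivity)) (NNReal.rpow_le_one ha1 (by positivity))
  have ha' : (0 : ℝ) < (a : ℝ) := ha
  have h' : ((gridPoints (mesh H₁ H₂ a)).card : ℝ) ≤
      9 * (((a : ℝ) ^ (1 / H₁))⁻¹ * ((a : ℝ) ^ (1 / H₂))⁻¹) := by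
    exact_mod_cast h
  rwa [← Real.inv_rpow ha'.le, ← Real.inv_rpow ha'.le, ← Real.rpow_add (inv_pos.2 ha')] at h'

lemma IsSheetLike.integral_sq_sub_mesh_le (hX : IsSheetLike X H₁ H₂ μ) (hH₁ : 0 < H₁)
    (hH₂ : 0 < H₂) {a : ℝ≥0} (ha : 0 < a) {t : ℝ≥0 × ℝ≥0} (ht : t ≤ (2, 2)) :
    ∫ ω, (X t ω - X (gridProj (mesh H₁ H₂ a) t) ω) ^ 2 ∂μ ≤
      4 * 4 ^ max H₁ H₂ * (a : ℝ) ^ 2 := by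
  refine (hX.integral_sq_sub_gridProj_le hH₁ hH₂ (NNReal.rpow_pos ha) (NNReal.rpow_pos ha)
    ht).trans ?_
  have hpow (H : ℝ) (hH : 0 < H) : ((a : ℝ) ^ (1 / H)) ^ (2 * H) = (a : ℝ) ^ 2 := by
    rw [← Real.rpow_mul a.coe_nonneg, ← Real.rpow_two]
    congr 1
    field_simp
  have h4 (H : ℝ) : (2 : ℝ) ^ (2 * H) = 4 ^ H := by
    rw [Real.rpow_mul zero_le_two]
    norm_num
  have g1 : (4 : ℝ) ^ H₁ ≤ 4 ^ max H₁ H₂ :=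
    Real.rpow_le_rpow_of_exponent_le (by norm_num) (le_max_left _ _)
  have g2 : (4 : ℝ) ^ H₂ ≤ 4 ^ max H₁ H₂ :=
    Real.rpow_le_rpow_of_exponent_le (by norm_num) (le_max_right _ _)
  simp only [mesh, NNReal.coe_rpow]
  rw [hpow _ hH₁, hpow _ hH₂, h4, h4]
  nlinarith [sq_nonneg (a : ℝ)]

/-! ### Chaining -/

/-- A path whose values on the coarsest grid and whose links between consecutive grids are
controlled is controlled on all grids. -/
lemma abs_le_of_links {f : ℝ≥0 × ℝ≥0 → ℝ} {h : ℕ → ℝ≥0 × ℝ≥0} {b : ℝ} {x : ℕ → ℝ}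
    (h0 : ∀ p ∈ gridPoints (h 0), |f p| ≤ b)
    (hlink : ∀ k, ∀ p ∈ gridPoints (h (k + 1)), |f p - f (gridProj (h k) p)| ≤ x k) (K : ℕ) :
    ∀ p ∈ gridPoints (h K), |f p| ≤ b + ∑ k ∈ Finset.range K, x k := by
  induction K with
  | zero => simpa using h0
  | succ K ih =>
    intro p hp
    have h1 := hlink K p hp
    have h2 := ih _ (gridProj_mem (h := h K) (le_of_mem_gridPoints hp))
    rw [Finset.sum_range_succ]
    have h3 := abs_add_le (f p - f (gridProj (h K) p)) (f (gridProj (h K) p))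
    rw [sub_add_cancel] at h3
    linarith

lemma IsSheetLike.tendstoInMeasure_mesh [IsProbabilityMeasure μ] (hX : IsSheetLike X H₁ H₂ μ)
    (hH₁ : 0 < H₁) (hH₂ : 0 < H₂) {a : ℕ → ℝ≥0} (ha : ∀ k, 0 < a k)
    (hlim : Tendsto a atTop (𝓝 0)) {t : ℝ≥0 × ℝ≥0} (ht : t ≤ (2, 2)) :
    TendstoInMeasure μ (fun k => X (gridProj (mesh H₁ H₂ (a k)) t)) atTop (X t) := by
  rw [tendstoInMeasure_iff_dist]
  intro γ hγ
  have hv (k : ℕ) : 0 < 4 * 4 ^ max H₁ H₂ * (a k : ℝ) ^ 2 := by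
    have := ha k
    positivity
  have hbound (k : ℕ) : μ {ω | γ ≤ dist (X (gridProj (mesh H₁ H₂ (a k)) t) ω) (X t ω)} ≤
      ENNReal.ofReal
        (2 * Real.exp (-((γ / 2) ^ 2 / (2 * (4 * 4 ^ max H₁ H₂ * (a k : ℝ) ^ 2))))) := by
    refine (measure_mono fun ω hω => ?_).trans
      (measure_abs_gt_le_of_hasGaussianLaw (hX.hasGaussianLaw_sub t
        (gridProj (mesh H₁ H₂ (a k)) t)) (hX.integral_sub _ _) (hv k)
        (hX.integral_sq_sub_mesh_le hH₁ hH₂ (ha k) ht) (by positivity))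
    have hω' : γ ≤ dist (X (gridProj (mesh H₁ H₂ (a k)) t) ω) (X t ω) := hω
    rw [dist_comm, Real.dist_eq] at hω'
    -- The Gaussian tail bound concerns a strict exceedance, hence γ / 2 in place of γ.
    exact (half_lt_self hγ).trans_le hω'
  refine tendsto_of_tendsto_of_tendsto_of_le_of_le tendsto_const_nhds ?_ (fun _ => zero_le)
    hbound
  rw [← ENNReal.ofReal_zero]
  refine ENNReal.tendsto_ofReal ?_
  have hlim' : Tendsto (fun k => 2 * (4 * 4 ^ max H₁ H₂ * (a k : ℝ) ^ 2)) atTop (𝓝[>] 0) := by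
    refine tendsto_nhdsWithin_iff.2 ⟨?_, Eventually.of_forall fun k => mul_pos two_pos (hv k)⟩
    have h1 : Tendsto (fun k => (a k : ℝ)) atTop (𝓝 0) := NNReal.tendsto_coe.2 hlim
    simpa using ((h1.pow 2).const_mul (4 * 4 ^ max H₁ H₂)).const_mul 2
  have h2 := (tendsto_inv_nhdsGT_zero.comp hlim').const_mul_atTop
    (show 0 < (γ / 2) ^ 2 by positivity)
  have h3 := (Real.tendsto_exp_neg_atTop_nhds_zero.comp h2).const_mul 2
  simpa [Function.comp_def, div_eq_mul_inv] using h3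

/-- The chaining bound for the supremum over a countable subset of `[0,2]²`. -/
lemma IsSheetLike.measure_exists_abs_gt_le [IsProbabilityMeasure μ] (hX : IsSheetLike X H₁ H₂ μ)
    (hH₁ : 0 < H₁) (hH₂ : 0 < H₂) {a : ℕ → ℝ≥0} (ha : ∀ k, 0 < a k)
    (hlim : Tendsto a atTop (𝓝 0)) {b u : ℝ} {x : ℕ → ℝ}
    (hx : ∀ K, b + ∑ k ∈ Finset.range K, x k ≤ u) {S : Set (ℝ≥0 × ℝ≥0)} (hS : S.Countable) :
    μ {ω | ∃ s ∈ S, s ≤ (2, 2) ∧ u < |X s ω|} ≤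
      ∑ p ∈ gridPoints (mesh H₁ H₂ (a 0)), μ {ω | b < |X p ω|} +
      ∑' k, ∑ p ∈ gridPoints (mesh H₁ H₂ (a (k + 1))),
        μ {ω | x k < |X p ω - X (gridProj (mesh H₁ H₂ (a k)) p) ω|} := by
  set B : Set Ω := (⋃ p ∈ gridPoints (mesh H₁ H₂ (a 0)), {ω | b < |X p ω|}) ∪
    ⋃ k, ⋃ p ∈ gridPoints (mesh H₁ H₂ (a (k + 1))),
      {ω | x k < |X p ω - X (gridProj (mesh H₁ H₂ (a k)) p) ω|} with hB
  -- No path continuity is needed: at each `s` grid values converge in probability, hence almost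
  -- surely along a subsequence, and countability of `S` leaves one null set.
  have hae : ∀ᵐ ω ∂μ, ∀ s ∈ S, s ≤ (2, 2) → ω ∉ B → |X s ω| ≤ u := by
    rw [ae_ball_iff hS]
    intro s _
    by_cases hs : s ≤ (2, 2)
    swap
    · exact Eventually.of_forall fun ω h => absurd h hs
    obtain ⟨ns, -, hns⟩ :=
      (hX.tendstoInMeasure_mesh hH₁ hH₂ ha hlim hs).exists_seq_tendsto_ae
    filter_upwards [hns] with ω hω _ hωB
    simp only [hB, mem_union, mem_iUnion, mem_ofPred_eq, not_or, not_exists, not_lt] at hωB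
    refine le_of_tendsto hω.abs (Eventually.of_forall fun i => ?_)
    exact (abs_le_of_links (f := fun p => X p ω) (h := fun k => mesh H₁ H₂ (a k)) hωB.1 hωB.2
      (ns i) _ (gridProj_mem hs)).trans (hx _)
  calc μ {ω | ∃ s ∈ S, s ≤ (2, 2) ∧ u < |X s ω|} ≤ μ B := by
        refine measure_mono_ae ?_
        filter_upwards [hae] with ω hω
        rintro ⟨s, hs, hs2, hsu⟩
        by_contra hωB
        exact (hω s hs hs2 hωB).not_gt hsu
    _ ≤ _ := by
        refine (measure_union_le _ _).trans (add_le_add (measure_biUnion_finset_le _ _) ?_)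
        exact (measure_iUnion_le _).trans
          (ENNReal.tsum_le_tsum fun k => measure_biUnion_finset_le _ _)

/-! ### Constants and the tail bound on [0,2]² -/

lemma two_le_Q (hH₁ : H₁ ∈ Ioo (0 : ℝ) 1) (hH₂ : H₂ ∈ Ioo (0 : ℝ) 1) : 2 ≤ Q H₁ H₂ := by
  have h1 := (one_le_one_div hH₁.1 hH₁.2.le)
  have h2 := (one_le_one_div hH₂.1 hH₂.2.le)
  rw [Q]
  linarith

lemma le_C₁ (hH₁ : 0 < H₁) (hH₂ : 0 < H₂) : 16 * Real.exp (Q H₁ H₂) ≤ C₁ H₁ H₂ := by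
  have key (a b : ℝ) (ha : 0 < a) (hb : 0 < b) : 1 ≤ ((a + b) / b) ^ (1 / a) := by
    refine Real.one_le_rpow ?_ (by positivity)
    rw [one_le_div hb]
    linarith
  have h1 : 4 ≤ N₁ H₁ H₂ := by
    have := key H₁ H₂ hH₁ hH₂
    rw [N₁]
    linarith
  have h2 : 4 ≤ N₂ H₁ H₂ := by
    have := key H₂ H₁ hH₂ hH₁
    rw [N₂, add_comm H₁]
    linarith
  have h3 : Real.exp (Q H₁ H₂) ≤ Real.exp (Q H₁ H₂ + 1 / (2 * ((4 : ℝ) ^ (H₁ + H₂) + 1))) := by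
    refine Real.exp_le_exp.2 ?_
    have : 0 ≤ 1 / (2 * ((4 : ℝ) ^ (H₁ + H₂) + 1)) := by positivity
    linarith
  rw [C₁]
  have h4 : 16 ≤ N₁ H₁ H₂ * N₂ H₁ H₂ := by nlinarith
  gcongr

lemma C₂_pos : 0 < C₂ H₁ H₂ := by
  rw [C₂]
  positivity

/-- With y = 4^H the left side is 3 / (2(3y + 4/y)), and 3y + 4/y ≥ 6. This controls the link
exponents. -/
lemma C₂_mul_le (hH₁ : 0 < H₁) (hH₂ : 0 < H₂) : C₂ H₁ H₂ * 4 ^ max H₁ H₂ ≤ 1 / 4 := by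
  rw [C₂, Real.rpow_sub (by norm_num), Real.rpow_one]
  have hy : (1 : ℝ) ≤ 4 ^ min H₁ H₂ := Real.one_le_rpow (by norm_num) (by positivity)
  have he : (0 : ℝ) < 4 ^ max H₁ H₂ := by positivity
  generalize (4 : ℝ) ^ min H₁ H₂ = y at *
  generalize (4 : ℝ) ^ max H₁ H₂ = e at *
  have h6 : 6 ≤ y * 3 + 4 / y := by
    have : y * 3 + 4 / y = (3 * y ^ 2 + 4) / y := by field_simp
    rw [this, le_div_iff₀ (by linarith)]
    nlinarith [sq_nonneg (y - 1)]
  have : 3 / (2 * e * (y * 3 + 4 / y)) * e = 3 / (2 * (y * 3 + 4 / y)) := by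
    field_simp
  rw [this, div_le_iff₀ (by linarith)]
  linarith

/-- Weighted Cauchy–Schwarz for u = (u - 1) + 1, namely (a + b)²/(p + q) ≤ a²/p + b²/q, with p =
2·4^{H₁+H₂} and q = (2/3)·4^{η+1-H}; then 1/(p + q) is exactly C₂, and 1/q ≤ 3/8 because η ≥ H. -/
lemma C₂_mul_sq_le (hH₁ : H₁ ∈ Ioo (0 : ℝ) 1) (hH₂ : H₂ ∈ Ioo (0 : ℝ) 1) (u : ℝ) :
    C₂ H₁ H₂ * u ^ 2 ≤ (u - 1) ^ 2 / (2 * 4 ^ (H₁ + H₂)) + 3 / 8 := by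
  have hM : (4 : ℝ) ^ (H₁ + H₂) = 4 ^ max H₁ H₂ * 4 ^ min H₁ H₂ := by
    rw [← Real.rpow_add (by norm_num), max_add_min]
  rw [C₂, hM]
  have hy : (1 : ℝ) ≤ 4 ^ min H₁ H₂ :=
    Real.one_le_rpow (by norm_num) (le_min hH₁.1.le hH₂.1.le)
  have he : (1 : ℝ) ≤ 4 ^ max H₁ H₂ :=
    Real.one_le_rpow (by norm_num) (hH₁.1.le.trans (le_max_left _ _))
  have hz : (1 : ℝ) ≤ 4 ^ (1 - min H₁ H₂) :=
    Real.one_le_rpow (by norm_num) (sub_nonneg.2 ((min_le_left _ _).trans hH₁.2.le))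
  have hez : (4 : ℝ) ≤ 4 ^ max H₁ H₂ * 4 ^ (1 - min H₁ H₂) := by
    rw [← Real.rpow_add (by norm_num)]
    refine Real.self_le_rpow_of_one_le (by norm_num) ?_
    have : min H₁ H₂ ≤ max H₁ H₂ := min_le_max
    linarith
  generalize (4 : ℝ) ^ min H₁ H₂ = y at *
  generalize (4 : ℝ) ^ max H₁ H₂ = e at *
  generalize (4 : ℝ) ^ (1 - min H₁ H₂) = z at *
  have h1 : 3 / (2 * e * (y * 3 + z)) * u ^ 2 ≤
      (u - 1) ^ 2 / (2 * (e * y)) + 3 / (2 * (e * z)) := by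
    rw [div_add_div _ _ (by positivity) (by positivity), div_mul_eq_mul_div,
      div_le_div_iff₀ (by positivity) (by positivity)]
    nlinarith [mul_nonneg (mul_nonneg (show 0 ≤ e by linarith) (show 0 ≤ e by linarith))
      (sq_nonneg ((u - 1) * z - 3 * y))]
  have h2 : 3 / (2 * (e * z)) ≤ 3 / 8 := by
    gcongr
    linarith
  linarith

lemma sum_range_half_pow_succ (K : ℕ) :
    ∑ k ∈ Finset.range K, (1 / 2 : ℝ) ^ (k + 1) = 1 - (1 / 2) ^ K := by
  induction K with
  | zero => simp
  | succ K ih =>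
    rw [Finset.sum_range_succ, ih]
    ring

lemma four_pow_rpow_mul_exp_le {q w : ℝ} (hq : 2 ≤ q) (hw : 2 * q ≤ w) (k : ℕ) :
    ((4 : ℝ) ^ (k + 1)) ^ q * Real.exp (-(2 * w * 4 ^ k)) ≤
      Real.exp (-w) * (1 / 2) ^ (k + 1) := by
  have h4 : (4 : ℝ) ^ (k + 1) = Real.exp ((k + 1 : ℕ) * (2 * Real.log 2)) := by
    rw [Real.exp_nat_mul, two_mul, Real.exp_add, Real.exp_log two_pos]
    norm_num
  have h2 : (1 / 2 : ℝ) ^ (k + 1) = Real.exp ((k + 1 : ℕ) * (-Real.log 2)) := by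
    rw [Real.exp_nat_mul, Real.exp_neg, Real.exp_log two_pos]
    norm_num
  have hb : 1 + (k : ℝ) * 3 ≤ 4 ^ k := by
    have := one_add_mul_le_pow (a := (3 : ℝ)) (by norm_num) k
    norm_num at this ⊢
    exact this
  rw [h4, h2, ← Real.exp_mul, ← Real.exp_add, ← Real.exp_add, Real.exp_le_exp]
  have hl := Real.log_two_lt_d9
  have hl0 := Real.log_nonneg (show (1 : ℝ) ≤ 2 by norm_num)
  have hk : (0 : ℝ) ≤ k := k.cast_nonneg
  push_cast
  -- The factor 0.7 comes from 2q ≤ w and log 2 < 0.7; the later 0.2 from w ≥ 4.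
  have e1 : ((k : ℝ) + 1) * (2 * Real.log 2) * q ≤ (k + 1) * (0.7 * w) := by
    rw [mul_assoc]
    refine mul_le_mul_of_nonneg_left ?_ (by positivity)
    nlinarith
  have e2 : 2 * w * (1 + k * 3) ≤ 2 * w * 4 ^ k := by
    gcongr
    linarith
  have e3 : ((k : ℝ) + 1) * Real.log 2 ≤ (k + 1) * (0.2 * w) := by
    gcongr
    linarith
  nlinarith [mul_nonneg hk (show 0 ≤ w by linarith)]

/-- The tail bound for the supremum over a countable subset of `[0,2]²`. -/
lemma IsSheetLike.measure_exists_abs_gt_le_C₁ [IsProbabilityMeasure μ]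
    (hX : IsSheetLike X H₁ H₂ μ) (hH₁ : H₁ ∈ Ioo (0 : ℝ) 1) (hH₂ : H₂ ∈ Ioo (0 : ℝ) 1)
    {u : ℝ} (hu : 2 < u) {S : Set (ℝ≥0 × ℝ≥0)} (hS : S.Countable) :
    μ {ω | ∃ s ∈ S, s ≤ (2, 2) ∧ u < |X s ω|} ≤
      ENNReal.ofReal (C₁ H₁ H₂ * u ^ (2 * Q H₁ H₂) * Real.exp (-(C₂ H₁ H₂ * u ^ 2))) := by
  -- A bound of at least 1 is trivial. Otherwise C₁ ≥ e^Q and u² > e force w = C₂u² ≥ 2Q ≥ 4, hence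
  -- u ≥ 4 since C₂ ≤ 1/4.
  rcases le_or_gt 1 (C₁ H₁ H₂ * u ^ (2 * Q H₁ H₂) * Real.exp (-(C₂ H₁ H₂ * u ^ 2))) with h1 | h1
  · exact prob_le_one.trans (ENNReal.one_le_ofReal.2 h1)
  have hQ := two_le_Q hH₁ hH₂
  have hC₁ := le_C₁ hH₁.1 hH₂.1
  have hC₂ := C₂_mul_le hH₁.1 hH₂.1
  have hC₂u := C₂_mul_sq_le hH₁ hH₂ u
  have hC₂0 : 0 < C₂ H₁ H₂ := C₂_pos
  have hu0 : 0 < u := by linarith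
  have hU : u ^ (2 * Q H₁ H₂) = (u ^ 2) ^ Q H₁ H₂ := by
    rw [Real.rpow_mul hu0.le, Real.rpow_two]
  rw [hU] at h1 ⊢
  obtain ⟨w, hw⟩ : ∃ w, w = C₂ H₁ H₂ * u ^ 2 := ⟨_, rfl⟩
  rw [← hw] at h1 hC₂u ⊢
  have hUQ : Real.exp (Q H₁ H₂) ≤ (u ^ 2) ^ Q H₁ H₂ := by
    rw [← Real.exp_one_rpow]
    have := Real.exp_one_lt_d9
    gcongr
    nlinarith
  have hw2 : 2 * Q H₁ H₂ ≤ w := by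
    have h2 : Real.exp (Q H₁ H₂) * Real.exp (Q H₁ H₂) * Real.exp (-w) ≤ 1 := by
      refine le_trans ?_ h1.le
      have e1 : Real.exp (Q H₁ H₂) ≤ C₁ H₁ H₂ := by
        have := Real.exp_pos (Q H₁ H₂)
        linarith
      have e2 : 0 ≤ C₁ H₁ H₂ := (Real.exp_pos _).le.trans e1
      gcongr
    rw [← Real.exp_add, ← Real.exp_add, Real.exp_le_one_iff] at h2
    linarith
  have he1 : (1 : ℝ) ≤ 4 ^ max H₁ H₂ :=
    Real.one_le_rpow (by norm_num) (hH₁.1.le.trans (le_max_left _ _))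
  have hu16 : 16 ≤ u ^ 2 := by
    have : C₂ H₁ H₂ ≤ 1 / 4 := by nlinarith
    nlinarith [sq_nonneg u]
  have hu4 : 4 ≤ u := by nlinarith
  set U := (u ^ 2) ^ Q H₁ H₂ with hUdef
  have hU0 : 0 < U := by positivity
  -- The start u⁻² yields the factor u^{2Q} in the grid size. Link deviations then scale like 4⁻ᵏ
  -- against thresholds 2^{-(k+1)}, so the link exponents grow like 4ᵏ.
  set a : ℕ → ℝ≥0 := fun k => ((u ^ 2)⁻¹ * (1 / 4) ^ k).toNNReal with ha
  have hak (k : ℕ) : (a k : ℝ) = (u ^ 2)⁻¹ * (1 / 4) ^ k :=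
    Real.coe_toNNReal _ (by positivity)
  have ha0 (k : ℕ) : 0 < a k := Real.toNNReal_pos.2 (by positivity)
  have ha1 (k : ℕ) : a k ≤ 1 := by
    rw [← NNReal.coe_le_coe, hak, NNReal.coe_one]
    exact mul_le_one₀ (inv_le_one_of_one_le₀ (by linarith)) (by positivity)
      (pow_le_one₀ (by norm_num) (by norm_num))
  have hlim : Tendsto a atTop (𝓝 0) := by
    rw [← NNReal.tendsto_coe]
    simp only [hak]
    have := tendsto_pow_atTop_nhds_zero_of_lt_one (r := (1 / 4 : ℝ)) (by norm_num) (by norm_num)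
    simpa using this.const_mul (u ^ 2)⁻¹
  have hcard (k : ℕ) : ((gridPoints (mesh H₁ H₂ (a k))).card : ℝ) ≤
      9 * (U * ((4 : ℝ) ^ k) ^ Q H₁ H₂) := by
    refine (card_gridPoints_mesh_le hH₁.1 hH₂.1 (ha0 k) (ha1 k)).trans_eq ?_
    rw [hak, hUdef, ← Real.mul_rpow (by positivity) (by positivity)]
    congr 2
    rw [mul_inv, inv_inv, one_div, inv_pow, inv_inv]
  have hchain := hX.measure_exists_abs_gt_le hH₁.1 hH₂.1 ha0 hlim (b := u - 1) (u := u)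
    (x := fun k => (1 / 2) ^ (k + 1)) (fun K => by
      rw [sum_range_half_pow_succ]
      have : (0 : ℝ) ≤ (1 / 2) ^ K := by positivity
      linarith) hS
  have hbase : ∑ p ∈ gridPoints (mesh H₁ H₂ (a 0)), μ {ω | u - 1 < |X p ω|} ≤
      ENNReal.ofReal (18 * U * Real.exp (-w) * 1.6) := by
    have hp (p) (hp : p ∈ gridPoints (mesh H₁ H₂ (a 0))) : μ {ω | u - 1 < |X p ω|} ≤
        ENNReal.ofReal (2 * (Real.exp (-w) * 1.6)) := by
      refine (measure_abs_gt_le_of_hasGaussianLaw (hX.gaussian.hasGaussianLaw_eval p)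
        (hX.centered p) (show (0 : ℝ) < 4 ^ (H₁ + H₂) by positivity)
        (hX.integral_sq_le hH₁.1 hH₂.1 (le_of_mem_gridPoints hp)) (by linarith)).trans ?_
      refine ENNReal.ofReal_le_ofReal ?_
      have h38 : Real.exp (3 / 8) ≤ 1.6 := by
        have := Real.one_sub_le_exp_neg (3 / 8)
        rw [Real.exp_neg] at this
        have := (le_inv_comm₀ (by norm_num) (Real.exp_pos _)).1 this
        norm_num at this ⊢
        exact this
      have : Real.exp (-((u - 1) ^ 2 / (2 * 4 ^ (H₁ + H₂)))) ≤
          Real.exp (-w) * Real.exp (3 / 8) := by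
        rw [← Real.exp_add, Real.exp_le_exp]
        linarith
      have := this.trans (mul_le_mul_of_nonneg_left h38 (Real.exp_pos _).le)
      linarith
    refine (Finset.sum_le_card_nsmul _ _ _ hp).trans ?_
    rw [nsmul_eq_mul, ← ENNReal.ofReal_natCast, ← ENNReal.ofReal_mul (Nat.cast_nonneg _)]
    refine ENNReal.ofReal_le_ofReal ?_
    have h0 := hcard 0
    rw [pow_zero, Real.one_rpow, mul_one] at h0
    calc _ ≤ 9 * U * (2 * (Real.exp (-w) * 1.6)) := by gcongr
      _ = _ := by ring
  have hlink (k : ℕ) : ∑ p ∈ gridPoints (mesh H₁ H₂ (a (k + 1))),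
        μ {ω | (1 / 2) ^ (k + 1) < |X p ω - X (gridProj (mesh H₁ H₂ (a k)) p) ω|} ≤
      ENNReal.ofReal (18 * U * Real.exp (-w) * (1 / 2) ^ (k + 1)) := by
    have hp (p) (hp : p ∈ gridPoints (mesh H₁ H₂ (a (k + 1)))) :
        μ {ω | (1 / 2) ^ (k + 1) < |X p ω - X (gridProj (mesh H₁ H₂ (a k)) p) ω|} ≤
        ENNReal.ofReal (2 * Real.exp (-(2 * w * 4 ^ k))) := by
      have hpos : 0 < 4 * 4 ^ max H₁ H₂ * (a k : ℝ) ^ 2 := by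
        have := ha0 k
        positivity
      refine (measure_abs_gt_le_of_hasGaussianLaw (hX.hasGaussianLaw_sub p _)
        (hX.integral_sub _ _) hpos
        (hX.integral_sq_sub_mesh_le hH₁.1 hH₂.1 (ha0 k) (le_of_mem_gridPoints hp))
        (by positivity)).trans ?_
      refine ENNReal.ofReal_le_ofReal ?_
      gcongr
      rw [le_div_iff₀ (by positivity), hak]
      have e1 : ((1 / 2 : ℝ) ^ (k + 1)) ^ 2 = (1 / 4) ^ k / 4 := by
        rw [← pow_mul, mul_comm, pow_mul, pow_succ]
        norm_num
        ring
      have e2 : (4 : ℝ) ^ k * (1 / 4) ^ k = 1 := by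
        rw [← mul_pow]
        norm_num
      have e3 : 2 * w * 4 ^ k * (2 * (4 * 4 ^ max H₁ H₂ * ((u ^ 2)⁻¹ * (1 / 4) ^ k) ^ 2)) =
          (16 * (C₂ H₁ H₂ * 4 ^ max H₁ H₂) * (u ^ 2)⁻¹) * (4 ^ k * (1 / 4) ^ k) * (1 / 4) ^ k := by
        rw [hw]
        field_simp
        ring
      have e4 : 16 * (C₂ H₁ H₂ * 4 ^ max H₁ H₂) * (u ^ 2)⁻¹ ≤ 1 / 4 := by
        calc 16 * (C₂ H₁ H₂ * 4 ^ max H₁ H₂) * (u ^ 2)⁻¹ ≤ 16 * (1 / 4) * (16)⁻¹ := by gcongr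
          _ = _ := by norm_num
      rw [e3, e2, e1, mul_one]
      refine (mul_le_mul_of_nonneg_right e4 (by positivity)).trans_eq ?_
      ring
    refine (Finset.sum_le_card_nsmul _ _ _ hp).trans ?_
    rw [nsmul_eq_mul, ← ENNReal.ofReal_natCast, ← ENNReal.ofReal_mul (Nat.cast_nonneg _)]
    refine ENNReal.ofReal_le_ofReal ?_
    calc _ ≤ 9 * (U * ((4 : ℝ) ^ (k + 1)) ^ Q H₁ H₂) * (2 * Real.exp (-(2 * w * 4 ^ k))) := by
          gcongr
          exact hcard _
      _ = 18 * U * (((4 : ℝ) ^ (k + 1)) ^ Q H₁ H₂ * Real.exp (-(2 * w * 4 ^ k))) := by ring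
      _ ≤ 18 * U * (Real.exp (-w) * (1 / 2) ^ (k + 1)) := by
          have := four_pow_rpow_mul_exp_le hQ hw2 k
          gcongr
      _ = _ := by ring
  have hgeom : HasSum (fun k : ℕ => (1 / 2 : ℝ) ^ (k + 1)) 1 := by
    simpa [pow_succ', div_eq_mul_inv] using hasSum_geometric_two' 1
  have hsum : ∑' k : ℕ, ENNReal.ofReal (18 * U * Real.exp (-w) * (1 / 2) ^ (k + 1)) =
      ENNReal.ofReal (18 * U * Real.exp (-w)) := by
    have := hgeom.mul_left (18 * U * Real.exp (-w))
    rw [← ENNReal.ofReal_tsum_of_nonneg (fun k => by positivity) this.summable, this.tsum_eq,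
      mul_one]
  refine hchain.trans ((add_le_add hbase (ENNReal.tsum_le_tsum hlink)).trans ?_)
  rw [hsum, ← ENNReal.ofReal_add (by positivity) (by positivity)]
  refine ENNReal.ofReal_le_ofReal ?_
  have h3 : 3 ≤ Real.exp (Q H₁ H₂) := by
    have := Real.add_one_le_exp (Q H₁ H₂)
    linarith
  -- 46.8 < 48 ≤ 16e^Q ≤ C₁.
  calc 18 * U * Real.exp (-w) * 1.6 + 18 * U * Real.exp (-w) = 46.8 * U * Real.exp (-w) := by ring
    _ ≤ _ := by
      gcongr
      linarith

/-! ### Summability and dyadic blocks -/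

/-- Since p^q ≤ e^{qp}, completing the square leaves a factor e^{-p}; thus the summability
assumption on φ is needed only for D = 1. -/
lemma rpow_mul_exp_neg_mul_sq_le {q c p : ℝ} (hq : 0 ≤ q) (hc : 0 < c) (hp : 0 < p) :
    p ^ q * Real.exp (-c * p ^ 2) ≤ Real.exp ((q + 1) ^ 2 / (4 * c)) * Real.exp (-1 * p) := by
  have h1 : p ^ q ≤ Real.exp (q * p) := by
    rw [Real.rpow_def_of_pos hp, Real.exp_le_exp, mul_comm]
    have := Real.log_le_sub_one_of_pos hp
    gcongr
    linarith
  refine (mul_le_mul_of_nonneg_right h1 (Real.exp_pos _).le).trans ?_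
  rw [← Real.exp_add, ← Real.exp_add, Real.exp_le_exp]
  have h2 : (q + 1) * p - c * p ^ 2 ≤ (q + 1) ^ 2 / (4 * c) := by
    rw [le_div_iff₀ (by positivity)]
    nlinarith [sq_nonneg (q + 1 - 2 * c * p)]
  linarith

lemma summable_rpow_mul_exp_neg_mul_sq {ι : Type*} {p : ι → ℝ} (hp : ∀ i, 0 < p i)
    (hsum : Summable fun i => Real.exp (-1 * p i)) {q c : ℝ} (hq : 0 ≤ q) (hc : 0 < c) :
    Summable fun i => p i ^ q * Real.exp (-c * p i ^ 2) :=
  Summable.of_nonneg_of_le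
    (fun i => mul_nonneg (Real.rpow_nonneg (hp i).le _) (Real.exp_pos _).le)
    (fun i => rpow_mul_exp_neg_mul_sq_le hq hc (hp i)) (hsum.mul_left _)

lemma monotone_quadrant {φ : ℝ → ℝ → ℝ}
    (hφmono₁ : ∀ y : ℝ, 0 < y → MonotoneOn (fun x => φ x y) (Ioi 0))
    (hφmono₂ : ∀ x : ℝ, 0 < x → MonotoneOn (fun y => φ x y) (Ioi 0)) {x x' y y' : ℝ}
    (hx : 0 < x) (hy : 0 < y) (hxx : x ≤ x') (hyy : y ≤ y') : φ x y ≤ φ x' y' :=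
  (hφmono₁ y hy hx (hx.trans_le hxx) hxx).trans
    (hφmono₂ x' (hx.trans_le hxx) hy (hy.trans_le hyy) hyy)

/-- A value at a point of a dyadic block is approximated by values at points of a separating set
below the upper right corner of the block. -/
lemma exists_mem_abs_gt {f : ℝ≥0 × ℝ≥0 → ℝ} {H₁ H₂ : ℝ} (hH₁ : 0 < H₁) (hH₂ : 0 < H₂)
    {S : Set (ℝ≥0 × ℝ≥0)} {t r : ℝ≥0 × ℝ≥0}
    (ht : ∀ δ : ℝ, 0 < δ → f t ∈ closure (f '' {s ∈ S | rho2 H₁ H₂ t s < δ}))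
    (h₁ : t.1 < r.1) (h₂ : t.2 < r.2) {v : ℝ} (hv : v < |f t|) :
    ∃ s ∈ S, s ≤ r ∧ v < |f s| := by
  have h₁' : (0 : ℝ) < r.1 - t.1 := sub_pos.2 h₁
  have h₂' : (0 : ℝ) < r.2 - t.2 := sub_pos.2 h₂
  have hδ : 0 < min (((r.1 : ℝ) - t.1) ^ H₁) (((r.2 : ℝ) - t.2) ^ H₂) :=
    lt_min (Real.rpow_pos_of_pos h₁' _) (Real.rpow_pos_of_pos h₂' _)
  obtain ⟨_, hy, s, ⟨hsS, hs⟩, rfl⟩ := mem_closure_iff.1 (ht _ hδ) {y | v < |y|}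
    (isOpen_lt continuous_const continuous_abs) hv
  have key (x y z H : ℝ) (hH : 0 < H) (hz : 0 < z - x) (h : |x - y| ^ H < (z - x) ^ H) :
      y ≤ z := by
    have := (Real.rpow_lt_rpow_iff (abs_nonneg _) hz.le hH).1 h
    have := neg_abs_le (x - y)
    linarith
  have n1 : 0 ≤ |(t.1 : ℝ) - s.1| ^ H₁ := by positivity
  have n2 : 0 ≤ |(t.2 : ℝ) - s.2| ^ H₂ := by positivity
  rw [rho2, lt_min_iff] at hs
  have k1 := key t.1 s.1 r.1 H₁ hH₁ h₁' (by linarith [hs.1])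
  have k2 := key t.2 s.2 r.2 H₂ hH₂ h₂' (by linarith [hs.2])
  exact ⟨s, hsS, ⟨NNReal.coe_le_coe.1 k1, NNReal.coe_le_coe.1 k2⟩, hy⟩

end GaussianField

theorem mainTheorem2 {Ω : Type*} [MeasurableSpace Ω] (μ : Measure Ω) [IsProbabilityMeasure μ]
    (H₁ H₂ : ℝ) (hH₁ : H₁ ∈ Ioo (0 : ℝ) 1) (hH₂ : H₂ ∈ Ioo (0 : ℝ) 1)
    (X : ℝ≥0 × ℝ≥0 → Ω → ℝ)
    (hGauss : IsGaussianProcess X μ)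
    (hcent : ∀ t, ∫ ω, X t ω ∂μ = 0)
    (hself : GaussianField.IsSelfSimilar X H₁ H₂ μ)
    (hincr : GaussianField.HasStationaryRectIncrements X μ)
    (hnorm : ∫ ω, X (1, 1) ω ^ 2 ∂μ = 1)
    (hsep : GaussianField.IsSeparableOn X GaussianField.quadrant (GaussianField.rho2 H₁ H₂) μ)
    (φ : ℝ → ℝ → ℝ)
    (hφpos : ∀ x y : ℝ, 0 < x → 0 < y → 0 < φ x y)
    (hφmono₁ : ∀ y : ℝ, 0 < y → MonotoneOn (fun x => φ x y) (Ioi 0))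
    (hφmono₂ : ∀ x : ℝ, 0 < x → MonotoneOn (fun y => φ x y) (Ioi 0))
    (hφsum : ∀ D : ℝ, 0 < D →
      Summable fun k : ℕ × ℕ => Real.exp (-D * φ (2 ^ k.1) (2 ^ k.2)))
    (ε : ℝ) (hε : 2 / φ 1 1 < ε) :
    (Summable fun k : ℕ × ℕ => φ (2 ^ k.1) (2 ^ k.2) ^ (2 * GaussianField.Q H₁ H₂) *
      Real.exp (-GaussianField.C₂ H₁ H₂ * ε ^ 2 * φ (2 ^ k.1) (2 ^ k.2) ^ 2)) ∧
    μ.real {ω | (ε : EReal) < ⨆ t ∈ GaussianField.quadrant,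
        ((|X t ω| / ((t.1 : ℝ) ^ H₁ * (t.2 : ℝ) ^ H₂ * φ t.1 t.2) : ℝ) : EReal)} ≤
      GaussianField.C₁ H₁ H₂ * ε ^ (2 * GaussianField.Q H₁ H₂) *
        ∑' n : ℕ, ∑' m : ℕ, φ (2 ^ n) (2 ^ m) ^ (2 * GaussianField.Q H₁ H₂) *
          Real.exp (-GaussianField.C₂ H₁ H₂ * ε ^ 2 * φ (2 ^ n) (2 ^ m) ^ 2) := by
  have hQ := GaussianField.two_le_Q hH₁ hH₂
  have hφ11 : 0 < φ 1 1 := hφpos 1 1 one_pos one_pos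
  have hε0 : 0 < ε := (by positivity : 0 < 2 / φ 1 1).trans hε
  have hC₁ : 0 < GaussianField.C₁ H₁ H₂ :=
    (by positivity : 0 < 16 * Real.exp (GaussianField.Q H₁ H₂)).trans_le
      (GaussianField.le_C₁ hH₁.1 hH₂.1)
  have hC₂ : 0 < GaussianField.C₂ H₁ H₂ := GaussianField.C₂_pos
  have hpos (k : ℕ × ℕ) : 0 < φ (2 ^ k.1) (2 ^ k.2) := hφpos _ _ (by positivity) (by positivity)
  have hsummable : Summable fun k : ℕ × ℕ =>
      φ (2 ^ k.1) (2 ^ k.2) ^ (2 * GaussianField.Q H₁ H₂) *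
        Real.exp (-GaussianField.C₂ H₁ H₂ * ε ^ 2 * φ (2 ^ k.1) (2 ^ k.2) ^ 2) := by
    have := GaussianField.summable_rpow_mul_exp_neg_mul_sq hpos (hφsum 1 one_pos)
      (q := 2 * GaussianField.Q H₁ H₂) (c := GaussianField.C₂ H₁ H₂ * ε ^ 2) (by linarith)
      (by positivity)
    simpa only [neg_mul] using this
  refine ⟨hsummable, ?_⟩
  have hX := GaussianField.isSheetLike hH₁.1 hH₂.1 hGauss hcent hself hincr hnorm
  obtain ⟨S, -, hScount, -, hS⟩ := hsep
  set Y : ℕ × ℕ → ℝ≥0 × ℝ≥0 → Ω → ℝ := fun k t ω =>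
    ((((2 ^ k.1 : ℝ≥0) : ℝ)) ^ H₁ * ((2 ^ k.2 : ℝ≥0) : ℝ) ^ H₂)⁻¹ *
      X (2 ^ k.1 * t.1, 2 ^ k.2 * t.2) ω with hY
  set S' : ℕ × ℕ → Set (ℝ≥0 × ℝ≥0) := fun k =>
    (fun s => (s.1 / 2 ^ k.1, s.2 / 2 ^ k.2)) '' S with hS'
  set B : ℕ × ℕ → Set Ω := fun k =>
    {ω | ∃ s ∈ S' k, s ≤ (2, 2) ∧ ε * φ (2 ^ k.1) (2 ^ k.2) < |Y k s ω|} with hB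
  -- Inclusion up to a null set is enough for the outer measure, so the supremum event need not be
  -- shown measurable.
  have hsub : ({ω | (ε : EReal) < ⨆ t ∈ GaussianField.quadrant,
        ((|X t ω| / ((t.1 : ℝ) ^ H₁ * (t.2 : ℝ) ^ H₂ * φ t.1 t.2) : ℝ) : EReal)} : Set Ω)
      ≤ᵐ[μ] ⋃ k, B k := by
    filter_upwards [hS] with ω hω hA
    obtain ⟨t, ht, htε⟩ : ∃ t ∈ GaussianField.quadrant,
        ε < |X t ω| / ((t.1 : ℝ) ^ H₁ * (t.2 : ℝ) ^ H₂ * φ t.1 t.2) := by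
      have hA' : (ε : EReal) < ⨆ t ∈ GaussianField.quadrant,
        ((|X t ω| / ((t.1 : ℝ) ^ H₁ * (t.2 : ℝ) ^ H₂ * φ t.1 t.2) : ℝ) : EReal) := hA
      simpa only [lt_iSup_iff, EReal.coe_lt_coe_iff, exists_prop] using hA'
    have ht1 : (0 : ℝ) < t.1 := zero_lt_one.trans_le ht.1
    have ht2 : (0 : ℝ) < t.2 := zero_lt_one.trans_le ht.2
    obtain ⟨n, hn, hn'⟩ := exists_nat_pow_near ht.1 (one_lt_two (α := ℝ≥0))
    obtain ⟨m, hm, hm'⟩ := exists_nat_pow_near ht.2 (one_lt_two (α := ℝ≥0))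
    have hnR : (2 : ℝ) ^ n ≤ t.1 := by exact_mod_cast hn
    have hmR : (2 : ℝ) ^ m ≤ t.2 := by exact_mod_cast hm
    have hc : (0 : ℝ) < ((2 : ℝ) ^ n) ^ H₁ * ((2 : ℝ) ^ m) ^ H₂ := by positivity
    have hφt := hφpos _ _ ht1 ht2
    have hv : ((2 : ℝ) ^ n) ^ H₁ * ((2 : ℝ) ^ m) ^ H₂ * (ε * φ (2 ^ n) (2 ^ m)) < |X t ω| := by
      rw [lt_div_iff₀ (by positivity)] at htε
      refine lt_of_le_of_lt ?_ htε
      have e1 := GaussianField.monotone_quadrant hφmono₁ hφmono₂ (by positivity) (by positivity)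
        hnR hmR
      have e2 : 0 < φ (2 ^ n) (2 ^ m) := hpos (n, m)
      calc _ = ε * (((2 : ℝ) ^ n) ^ H₁ * ((2 : ℝ) ^ m) ^ H₂ * φ (2 ^ n) (2 ^ m)) := by ring
        _ ≤ _ := by
          have := hH₁.1
          have := hH₂.1
          gcongr
    -- The point `s` may leave the block downwards or to the left, but stays below its upper right
    -- corner; this is why the tail bound covers [0,2]² and not just [1,2]².
    obtain ⟨s, hsS, hsr, hsv⟩ := GaussianField.exists_mem_abs_gt (f := fun t => X t ω)
      (r := (2 ^ (n + 1), 2 ^ (m + 1))) hH₁.1 hH₂.1 (hω t ht) hn' hm' hv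
    refine mem_iUnion.2 ⟨(n, m), (s.1 / 2 ^ n, s.2 / 2 ^ m), ⟨s, hsS, rfl⟩, ⟨?_, ?_⟩, ?_⟩
    · exact div_le_of_le_mul₀ zero_le zero_le (hsr.1.trans_eq (pow_succ' _ _))
    · exact div_le_of_le_mul₀ zero_le zero_le (hsr.2.trans_eq (pow_succ' _ _))
    · have e1 (j : ℕ) (x : ℝ≥0) : 2 ^ j * (x / 2 ^ j) = x := mul_div_cancel₀ _ (by positivity)
      simp only [hY, e1, NNReal.coe_pow, NNReal.coe_ofNat]
      rw [abs_mul, abs_of_pos (inv_pos.2 hc), inv_mul_eq_div, lt_div_iff₀ hc, mul_comm]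
      exact hsv
  have hBle (k : ℕ × ℕ) : μ (B k) ≤ ENNReal.ofReal (GaussianField.C₁ H₁ H₂ *
      ε ^ (2 * GaussianField.Q H₁ H₂) * (φ (2 ^ k.1) (2 ^ k.2) ^ (2 * GaussianField.Q H₁ H₂) *
        Real.exp (-GaussianField.C₂ H₁ H₂ * ε ^ 2 * φ (2 ^ k.1) (2 ^ k.2) ^ 2))) := by
    have hYk : GaussianField.IsSheetLike (Y k) H₁ H₂ μ :=
      hX.scale (a := 2 ^ k.1) (b := 2 ^ k.2) (by positivity) (by positivity)
    -- The lower bound on ε enters here: by monotonicity of φ it gives the level u > 2 on every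
    -- block at once.
    have h2 : 2 < ε * φ (2 ^ k.1) (2 ^ k.2) := by
      have e1 : φ 1 1 ≤ φ (2 ^ k.1) (2 ^ k.2) :=
        GaussianField.monotone_quadrant hφmono₁ hφmono₂ one_pos one_pos
          (one_le_pow₀ one_le_two) (one_le_pow₀ one_le_two)
      rw [div_lt_iff₀ hφ11] at hε
      exact hε.trans_le (by gcongr)
    refine (hYk.measure_exists_abs_gt_le_C₁ hH₁ hH₂ h2 (hScount.image _)).trans_eq ?_
    rw [Real.mul_rpow hε0.le (hpos k).le, mul_pow]
    congr 1
    ring_nf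
  have hprod := hsummable.tsum_prod
  rw [← hprod, ← tsum_mul_left]
  refine ENNReal.toReal_le_of_le_ofReal (tsum_nonneg fun k => ?_) ?_
  · have := hpos k
    positivity
  rw [ENNReal.ofReal_tsum_of_nonneg (fun k => by have := hpos k; positivity)
    (hsummable.mul_left _)]
  exact (measure_mono_ae hsub).trans ((measure_iUnion_le _).trans (ENNReal.tsum_le_tsum hBle))
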